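/- For a group $G$ and $g,h\in G$, let $\mathrm{PA}_G(g,h)\in\mathbb N_{\ge1}\cup\{\infty\}$ be the smallest $n\ge 1$ such that $g^n$ and $h^n$ commute or $\langle g^n,h^n\rangle\cong F_2$ (and $\infty$ if there is none), and let $\mathrm{PA}(G)=\sup_{g,h\in G}\mathrm{PA}_G(g,h)$. We say that $G$ satisfies the uniform power alternative if there is a single $n\ge 1$ such that, for all $g,h\in G$, either $g^n$ and $h^n$ commute or $\langle g^n,h^n\rangle\cong F_2$. Let $G$ be a group acting by graph automorphisms on a simplicial tree $T$ with path metric $d$. Suppose that the action is - acylindrical: for each $\epsilon\ge 0$ there are $R,N<\infty$ such that $|\{g\in G: d(x,gx)\le\epsilon,\ d(y,gy)\le\epsilon\}|\le N$ for all vertices $x,y$ of $T$ with $d(x,y)>R$; - cocompact: there is a finite subgraph of $T$ whose $G$-translates cover $T$. Suppose that, for each vertex $v$ of $T$, the stabiliser $G_v$ satisfies $\mathrm{PA}(G_v)<\infty$ and is closed under roots, i.e. if $g\in G$ and $g^n\in G_v$ for some integer $n\neq 0$, then $g\in G_v$. Then $\mathrm{PA}(G)<\infty$, and $G$ satisfies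 the uniform power alternative. If moreover $T$ has infinite diameter, then there is a bound on the orders of the finite-order elements of $G$. -/

import Mathlib

/-- The subgroup generated by `a` and `b` is isomorphic to the free group of rank two. -/
def GeneratesFreeGroupOfRankTwo {G : Type*} [Group G] (a b : G) : Prop :=
  Nonempty (Subgroup.closure ({a, b} : Set G) ≃* FreeGroup (Fin 2))

/-- The `n`-th powers of `g` and `h` commute or generate a free group of rank two. -/
def PowerAlternativeAt {G : Type*} [Group G] (n : ℕ) (g h : G) : Prop :=
  Commute (g ^ n) (h ^ n) ∨ GeneratesFreeGroupOfRankTwo (g ^ n) (h ^ n)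

/-- `PA_G(g, h)`: the smallest `n ≥ 1` such that the `n`-th powers of `g` and `h` commute or
generate a free group of rank two, and `∞` if there is no such `n`. -/
noncomputable def powerAlternativeFunction {G : Type*} [Group G] (g h : G) : ℕ∞ :=
  ⨅ (n : ℕ) (_ : 1 ≤ n ∧ PowerAlternativeAt n g h), (n : ℕ∞)

/-- `PA(G)`, the supremum of `PA_G(g, h)` over all `g, h` in `G`. -/
noncomputable def powerAlternativeConstant (G : Type*) [Group G] : ℕ∞ :=
  ⨆ (g : G) (h : G), powerAlternativeFunction g h

/-- The uniform power alternative: one exponent works for all pairs of elements. -/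
def UniformPowerAlternative (G : Type*) [Group G] : Prop :=
  ∃ n : ℕ, 1 ≤ n ∧ ∀ g h : G, PowerAlternativeAt n g h

/-- There is a bound on the orders of the elements of finite order. -/
def HasBoundedTorsion (G : Type*) [Group G] : Prop :=
  ∃ B : ℕ, ∀ g : G, IsOfFinOrder g → orderOf g ≤ B

/-- Closure of a subgroup under roots. -/
def IsClosedUnderRoots {G : Type*} [Group G] (H : Subgroup G) : Prop :=
  ∀ (g : G) (n : ℤ), n ≠ 0 → g ^ n ∈ H → g ∈ H

/-- `G` acts on the graph `T` by graph automorphisms. -/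
def ActsByGraphAutomorphisms (G : Type*) [Group G] {V : Type*} [MulAction G V]
    (T : SimpleGraph V) : Prop :=
  ∀ (g : G) (v w : V), T.Adj (g • v) (g • w) ↔ T.Adj v w

/-- Acylindricity of the action of `G` on the vertices of `T`, with the graph metric. -/
def IsAcylindricalAction (G : Type*) [Group G] {V : Type*} [MulAction G V]
    (T : SimpleGraph V) : Prop :=
  ∀ ε : ℝ, 0 ≤ ε → ∃ (R : ℝ) (N : ℕ), ∀ x y : V, R < (T.dist x y : ℝ) →
    {g : G | (T.dist x (g • x) : ℝ) ≤ ε ∧ (T.dist y (g • y) : ℝ) ≤ ε}.encard ≤ (N : ℕ∞)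

/-- Cocompactness: the translates of some finite subgraph `K` cover all vertices and all edges
of `T`. -/
def IsCocompactAction (G : Type*) [Group G] {V : Type*} [MulAction G V]
    (T : SimpleGraph V) : Prop :=
  ∃ K : T.Subgraph, K.verts.Finite ∧ (∀ v : V, ∃ g : G, g • v ∈ K.verts) ∧
    ∀ v w : V, T.Adj v w → ∃ g : G, K.Adj (g • v) (g • w)

/-- The graph metric of `T` is unbounded. -/
def HasInfiniteDiameter {V : Type*} (T : SimpleGraph V) : Prop :=
  ∀ D : ℕ, ∃ v w : V, D < T.dist v w

/-!
Since vertex stabilisers are closed under roots, an element and all its nontrivial powers fix the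
same vertices, no edge is inverted, and elements of finite order act trivially on the tree. Thus
acylindricity (at displacement zero: at most `N` elements fix two vertices at distance more than
`R`) bounds torsion at once, and every element is either elliptic or translates a line, its axis
(`exists_axis`). Let `g` and `h` be two elements.

* If they have a common fixed vertex, the hypothesis on its stabiliser applies; up to conjugation
  only finitely many stabilisers occur.
* If both are elliptic without a common fixed vertex, all their nontrivial powers play ping-pong
  with the two sides of the bridge between the fixed subtrees
  (`generatesFreeGroupOfRankTwo_of_elliptic`).
* Otherwise let `g` translate the axis `ℓ` by `τ`, where `h` is elliptic or has translation length
  at most `τ`. If for some `k ≠ 0` the line `h ^ k • ℓ` has projection of length at least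
  `(N + R + 1) τ` to `ℓ`, a pigeonhole argument shows that `h ^ (2 k)` commutes with a power of `g`;
  then `h` itself translates `ℓ` (possibly by zero), and a second pigeonhole argument for the
  commutators `[g, h ^ j]`, which fix `ℓ` pointwise, shows that `g` commutes with `h ^ m` for some
  `1 ≤ m ≤ N`. The same conclusion holds if the axis of `h` has a long overlap with `ℓ`. If none of
  this happens, all the lines `h ^ k • ℓ` with `k ≠ 0` project into one ball of `ℓ` whose radius is
  a uniform multiple of `τ`, and `g ^ n` and `h ^ n` play ping-pong for a uniform `n`, by
  Behrstock's inequality for projections to lines in a tree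
  (`generatesFreeGroupOfRankTwo_of_proj`).

A single exponent results because the power alternative passes to multiples of the exponent: two
elements of a free group commute or generate a free group of rank two, by the Nielsen–Schreier
theorem (`PowerAlternativeAt.of_dvd`).

The geometry of the tree enters only through its integral metric: the four-point condition
(`SimpleGraph.IsTree.four_point`) and the fact that the distances from a vertex to the two ends of
an edge differ by one. Projections to a line `ℓ : ℤ → V` are recorded by the index of the projected point (`SimpleGraph.IsProj`).
-/

/-! ### Pairs of elements generating a free group of rank two -/

theorem PowerAlternativeAt.symm {G : Type*} [Group G] {n : ℕ} {g h : G}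
    (H : PowerAlternativeAt n g h) : PowerAlternativeAt n h g := by
  rcases H with H | H
  · exact Or.inl H.symm
  · right
    rw [GeneratesFreeGroupOfRankTwo, Set.pair_comm]
    exact H

theorem generatesFreeGroupOfRankTwo_map_iff {G H : Type*} [Group G] [Group H] (f : G →* H)
    (hf : Function.Injective f) (a b : G) :
    GeneratesFreeGroupOfRankTwo (f a) (f b) ↔ GeneratesFreeGroupOfRankTwo a b := by
  have e : Subgroup.closure ({a, b} : Set G) ≃* Subgroup.closure ({f a, f b} : Set H) := by
    rw [← Set.image_pair, ← MonoidHom.map_closure]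
    exact Subgroup.equivMapOfInjective _ f hf
  exact ⟨fun ⟨φ⟩ => ⟨e.trans φ⟩, fun ⟨φ⟩ => ⟨e.symm.trans φ⟩⟩

theorem powerAlternativeAt_map_iff {G H : Type*} [Group G] [Group H] (f : G →* H)
    (hf : Function.Injective f) (n : ℕ) (a b : G) :
    PowerAlternativeAt n (f a) (f b) ↔ PowerAlternativeAt n a b := by
  unfold PowerAlternativeAt
  rw [← map_pow, ← map_pow, generatesFreeGroupOfRankTwo_map_iff f hf]
  refine or_congr ⟨fun h => hf ?_, fun h => h.map f⟩ Iff.rfl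
  simpa using h.eq

/-- The number of free generators of a group generated by two elements is at most two, since a
homomorphism to `ℤ/2` is determined by its values on the two elements. -/
theorem FreeGroup.card_le_two_of_closure_pair_eq_top {S : Type*} (a b : FreeGroup S)
    (hab : Subgroup.closure ({a, b} : Set (FreeGroup S)) = ⊤) : Finite S ∧ Nat.card S ≤ 2 := by
  classical
  let M := Multiplicative (ZMod 2)
  have hinj : Function.Injective
      (fun φ : S → M => (FreeGroup.lift φ a, FreeGroup.lift φ b)) := by
    intro φ ψ h
    simp only [Prod.mk.injEq] at h
    apply FreeGroup.lift.injective
    refine MonoidHom.eq_of_eqOn_dense hab ?_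
    rintro x (rfl | rfl)
    · exact h.1
    · exact h.2
  have hfin : Finite (S → M) := Finite.of_injective _ hinj
  have hS : Finite S := by
    refine Finite.of_injective (fun s : S => (Pi.mulSingle s (Multiplicative.ofAdd 1) : S → M)) ?_
    intro s t hst
    by_contra hne
    have := congrFun hst s
    simp only [Pi.mulSingle_eq_same, Pi.mulSingle_eq_of_ne hne] at this
    exact absurd this (by decide)
  refine ⟨hS, ?_⟩
  have hle := Nat.card_le_card_of_injective _ hinj
  have hM : Nat.card M = 2 := Nat.card_zmod 2
  rw [Nat.card_prod, Nat.card_fun, hM] at hle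
  exact (Nat.pow_le_pow_iff_right (a := 2) (by norm_num)).1 hle

/-- In a free group two elements either commute or generate a free group of rank two: by the
Nielsen–Schreier theorem they generate a free group, whose rank is at most two. -/
theorem IsFreeGroup.commute_or_generatesFreeGroupOfRankTwo {F : Type*} [Group F] [IsFreeGroup F]
    (a b : F) : Commute a b ∨ GeneratesFreeGroupOfRankTwo a b := by
  let K := Subgroup.closure ({a, b} : Set F)
  let S := IsFreeGroup.Generators K
  let e : K ≃* FreeGroup S := IsFreeGroup.toFreeGroup K
  have ha : a ∈ K := Subgroup.subset_closure (by simp)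
  have hb : b ∈ K := Subgroup.subset_closure (by simp)
  have htop : Subgroup.closure ({⟨a, ha⟩, ⟨b, hb⟩} : Set K) = ⊤ := by
    apply Subgroup.map_injective K.subtype_injective
    rw [MonoidHom.map_closure, Set.image_pair, ← MonoidHom.range_eq_map, Subgroup.range_subtype]
    rfl
  have htop' : Subgroup.closure ({e ⟨a, ha⟩, e ⟨b, hb⟩} : Set (FreeGroup S)) = ⊤ := by
    have := congrArg (Subgroup.map e.toMonoidHom) htop
    rw [MonoidHom.map_closure, Set.image_pair, ← MonoidHom.range_eq_map,
      MonoidHom.range_eq_top.2 e.surjective] at this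
    exact this
  obtain ⟨hfin, hcard⟩ := FreeGroup.card_le_two_of_closure_pair_eq_top _ _ htop'
  by_cases h2 : Nat.card S = 2
  · right
    exact ⟨e.trans (FreeGroup.freeGroupCongr (Finite.equivFinOfCardEq h2))⟩
  · left
    have hsub : Subsingleton S := (Finite.card_le_one_iff_subsingleton).1 (by omega)
    have hcomm : ∀ x y : FreeGroup S, x * y = y * x := by
      rcases isEmpty_or_nonempty S with hS | ⟨⟨s⟩⟩
      · intro x y
        exact Subsingleton.elim _ _
      · have : Unique S := ⟨⟨s⟩, fun t => Subsingleton.elim _ _⟩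
        intro x y
        apply (FreeGroup.mulEquivIntOfUnique (α := S)).injective
        rw [map_mul, map_mul, mul_comm]
    have h := hcomm (e ⟨a, ha⟩) (e ⟨b, hb⟩)
    rw [← map_mul, ← map_mul] at h
    exact congrArg Subtype.val (e.injective h)

/-- The power alternative passes to multiples of the exponent. -/
theorem PowerAlternativeAt.of_dvd {G : Type*} [Group G] {k n : ℕ} {g h : G}
    (H : PowerAlternativeAt k g h) (hkn : k ∣ n) : PowerAlternativeAt n g h := by
  obtain ⟨m, rfl⟩ := hkn
  unfold PowerAlternativeAt
  rw [pow_mul, pow_mul]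
  rcases H with H | ⟨⟨e⟩⟩
  · exact Or.inl (H.pow_pow m m)
  · let K := Subgroup.closure ({g ^ k, h ^ k} : Set G)
    have : IsFreeGroup K := IsFreeGroup.ofMulEquiv e.symm
    let a : K := ⟨g ^ k, Subgroup.subset_closure (by simp)⟩
    let b : K := ⟨h ^ k, Subgroup.subset_closure (by simp)⟩
    rcases IsFreeGroup.commute_or_generatesFreeGroupOfRankTwo (a ^ m) (b ^ m) with hc | hf
    · exact Or.inl (congrArg Subtype.val hc.eq)
    · exact Or.inr ((generatesFreeGroupOfRankTwo_map_iff K.subtype K.subtype_injective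
        (a ^ m) (b ^ m)).2 hf)

theorem exists_powerAlternativeAt_of_function_le {G : Type*} [Group G] {g h : G} {B : ℕ}
    (H : powerAlternativeFunction g h ≤ B) : ∃ n, 1 ≤ n ∧ n ≤ B ∧ PowerAlternativeAt n g h := by
  by_contra! hne
  have : ((B + 1 : ℕ) : ℕ∞) ≤ powerAlternativeFunction g h := by
    refine le_iInf₂ fun n hn => ?_
    by_contra hlt
    rw [Nat.cast_le, not_le] at hlt
    exact hne n hn.1 (by omega) hn.2
  have h' := this.trans H
  rw [Nat.cast_le] at h'
  omega

theorem exists_powerAlternativeAt_of_constant_lt_top {G : Type*} [Group G]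
    (H : powerAlternativeConstant G < ⊤) :
    ∃ B : ℕ, ∀ g h : G, ∃ n, 1 ≤ n ∧ n ≤ B ∧ PowerAlternativeAt n g h := by
  obtain ⟨B, hB⟩ := ENat.ne_top_iff_exists.1 H.ne
  refine ⟨B, fun g h => exists_powerAlternativeAt_of_function_le ?_⟩
  rw [hB]
  exact le_iSup₂ (f := fun g h : G => powerAlternativeFunction g h) g h

theorem UniformPowerAlternative.powerAlternativeConstant_lt_top {G : Type*} [Group G]
    (H : UniformPowerAlternative G) : powerAlternativeConstant G < ⊤ := by
  obtain ⟨n, hn, H⟩ := H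
  refine lt_of_le_of_lt (iSup₂_le fun g h => ?_) (ENat.natCast_lt_top n)
  exact iInf₂_le n ⟨hn, H g h⟩

/-- Ping-pong with two disjoint sets: the nontrivial powers of `a` map `Y` into `X` and those of `b`
map `X` into `Y`. -/
theorem generatesFreeGroupOfRankTwo_of_ping_pong {G α : Type*} [Group G] [MulAction G α]
    (a b : G) (X Y : Set α) (hX : X.Nonempty) (hY : Y.Nonempty) (hXY : Disjoint X Y)
    (ha : ∀ k : ℤ, k ≠ 0 → ∀ y ∈ Y, a ^ k • y ∈ X)
    (hb : ∀ k : ℤ, k ≠ 0 → ∀ x ∈ X, b ^ k • x ∈ Y) : GeneratesFreeGroupOfRankTwo a b := by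
  let c : Fin 2 → G := ![a, b]
  let Z : Fin 2 → Set α := ![X, Y]
  have hinj : Function.Injective (FreeGroup.lift c) := by
    have hc : FreeGroup.lift c =
        (Monoid.CoprodI.lift fun i => FreeGroup.lift fun _ : Unit => c i).comp
          (freeGroupEquivCoprodI (ι := Fin 2)).toMonoidHom := by
      ext i
      simp
    rw [hc, MonoidHom.coe_comp]
    refine Function.Injective.comp ?_ (MulEquiv.injective freeGroupEquivCoprodI)
    refine Monoid.CoprodI.lift_injective_of_ping_pong
      (H := fun _ : Fin 2 => FreeGroup Unit) _ (Or.inr ⟨0, ?_⟩) Z ?_ ?_ ?_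
    · rw [FreeGroup.freeGroupUnitEquivInt.cardinal_eq, Cardinal.mk_denumerable]
      exact Cardinal.natCast_le_aleph0
    · intro i
      fin_cases i
      · exact hX
      · exact hY
    · intro i j hij
      fin_cases i <;> fin_cases j
      · exact absurd rfl hij
      · exact hXY
      · exact hXY.symm
      · exact absurd rfl hij
    · have key : ∀ (x : G) (u : FreeGroup Unit), u ≠ 1 → ∃ k : ℤ, k ≠ 0 ∧
          FreeGroup.lift (fun _ : Unit => x) u = x ^ k := by
        intro x u hu
        obtain ⟨k, rfl⟩ := FreeGroup.freeGroupUnitEquivInt.symm.surjective u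
        refine ⟨k, ?_, ?_⟩
        · rintro rfl
          exact hu (by simp [FreeGroup.freeGroupUnitEquivInt])
        · simp [FreeGroup.freeGroupUnitEquivInt]
      intro i j hij u hu
      obtain ⟨k, hk, hku⟩ := key (c i) u hu
      rw [hku]
      rintro _ ⟨z, hz, rfl⟩
      fin_cases i <;> fin_cases j
      · exact absurd rfl hij
      · exact ha k hk z hz
      · exact hb k hk z hz
      · exact absurd rfl hij
  have hr : Subgroup.closure ({a, b} : Set G) = (FreeGroup.lift c).range := by
    rw [FreeGroup.range_lift_eq_closure]
    congr 1
    simp [c, Set.pair_comm]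
  unfold GeneratesFreeGroupOfRankTwo
  rw [hr]
  exact ⟨(MonoidHom.ofInjective hinj).symm⟩

/-! ### The metric of a tree -/

namespace SimpleGraph

variable {V : Type*} {T : SimpleGraph V}

/-- If `y` lies on the `x'` side and `z` on the `x` side of an edge `x x'`, then the geodesic from
`y` to `z` crosses the edge. -/
theorem IsTree.dist_eq_add_of_adj (hT : T.IsTree) {x x' y z : V} (hx : T.Adj x x')
    (hy : T.dist y x = T.dist y x' + 1) (hz : T.dist z x' = T.dist z x + 1) :
    T.dist y z = T.dist y x + T.dist x z := by
  classical
  obtain ⟨p, hp, hpl⟩ := hT.connected.exists_path_of_dist y x'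
  obtain ⟨q, hq, hql⟩ := hT.connected.exists_path_of_dist x z
  have hdisj : ∀ t, t ∈ p.support → t ∈ q.support → False := by
    intro t htp htq
    have h1 : T.dist y t + T.dist t x' ≤ T.dist y x' := by
      rw [← hpl, ← p.take_spec htp, Walk.length_append]
      exact add_le_add (dist_le _) (dist_le _)
    have h2 : T.dist x t + T.dist t z ≤ T.dist x z := by
      rw [← hql, ← q.take_spec htq, Walk.length_append]
      exact add_le_add (dist_le _) (dist_le _)
    have h3 := hT.connected.dist_triangle (u := y) (v := t) (w := x)
    have h4 := hT.connected.dist_triangle (u := z) (v := t) (w := x')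
    simp only [T.dist_comm (u := t) (v := x), T.dist_comm (u := z) (v := t),
      T.dist_comm (u := z) (v := x)] at *
    omega
  let r : T.Walk y z := p.append (Walk.cons hx.symm q)
  have hr : r.IsPath := by
    rw [Walk.isPath_def, Walk.support_append, Walk.support_cons, List.tail_cons,
      List.nodup_append]
    refine ⟨hp.support_nodup, hq.support_nodup, ?_⟩
    rintro s hs t ht rfl
    exact hdisj s hs ht
  obtain ⟨r', hr', hrl'⟩ := hT.connected.exists_path_of_dist y z
  have heq : r = r' := congrArg Subtype.val 
    ((hT.isAcyclic.subsingleton_path y z).elim ⟨r, hr⟩ ⟨r', hr'⟩)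
  rw [← hrl', ← heq]
  simp only [r, Walk.length_append, Walk.length_cons, hpl, hql, hy]
  omega

/-- A first step towards `y`. -/
theorem Connected.exists_adj_dist_succ (hT : T.Connected) {x y : V} (hne : x ≠ y) :
    ∃ x', T.Adj x x' ∧ T.dist x y = T.dist x' y + 1 := by
  obtain ⟨p, hp⟩ := hT.exists_walk_length_eq_dist x y
  cases p with
  | nil => exact absurd rfl hne
  | @cons _ x' _ h q =>
    refine ⟨x', h, ?_⟩
    rw [Walk.length_cons] at hp
    have h1 := dist_le q
    have h2 := hT.dist_triangle (u := x) (v := x') (w := y)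
    rw [dist_eq_one_iff_adj.2 h] at h2
    omega

/-- The four-point condition: a tree is `0`-hyperbolic. -/
theorem IsTree.four_point (hT : T.IsTree) (x y z w : V) :
    T.dist x y + T.dist z w ≤ T.dist x z + T.dist y w ∨
      T.dist x y + T.dist z w ≤ T.dist x w + T.dist y z := by
  induction hn : T.dist x y generalizing x with
  | zero =>
    have hxy := hT.connected.dist_eq_zero_iff.1 hn
    subst hxy
    right
    rw [T.dist_comm (u := x) (v := w), T.dist_comm (u := x) (v := z), add_comm (T.dist w x),
      zero_add, T.dist_comm (u := w)]
    exact hT.connected.dist_triangle.trans (by rw [T.dist_comm (u := z) (v := x)])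
  | succ n ih =>
    have hne : x ≠ y := by
      rintro rfl
      simp at hn
    obtain ⟨x', hx, hd⟩ := hT.connected.exists_adj_dist_succ hne
    have hc : ∀ u, T.dist u x = T.dist x u ∧ T.dist u x' = T.dist x' u :=
      fun u => ⟨T.dist_comm, T.dist_comm⟩
    have hy : T.dist y x = T.dist y x' + 1 := by
      rw [(hc y).1, (hc y).2, hd]
    have ih := ih x' (by omega)
    rcases hT.dist_eq_dist_add_one_of_adj z hx with hz | hz
    · rcases hT.dist_eq_dist_add_one_of_adj w hx with hw | hw
      · rw [(hc z).1, (hc z).2] at hz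
        rw [(hc w).1, (hc w).2] at hw
        omega
      · left
        have h1 := hT.dist_eq_add_of_adj hx hy hw
        have h2 := hT.connected.dist_triangle (u := z) (v := x) (w := w)
        rw [(hc z).1] at h2
        rw [(hc y).1] at h1
        omega
    · right
      have h1 := hT.dist_eq_add_of_adj hx hy hz
      have h2 := hT.connected.dist_triangle (u := z) (v := x) (w := w)
      rw [(hc z).1] at h2
      rw [(hc y).1] at h1
      omega

theorem IsTree.eq_of_adj_of_dist (hT : T.IsTree) {x y a b : V} (ha : T.Adj x a) (hb : T.Adj x b)
    (hay : T.dist x y = T.dist a y + 1) (hby : T.dist x y = T.dist b y + 1) : a = b := by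
  have h := hT.four_point a b x y
  have h1 := dist_eq_one_iff_adj.2 ha
  have h2 := dist_eq_one_iff_adj.2 hb
  rw [T.dist_comm] at h1 h2
  rw [← hT.connected.dist_eq_zero_iff]
  omega

/-- A point of a geodesic is determined by its distance to an endpoint. -/
theorem IsTree.eq_of_dist_eq_add (hT : T.IsTree) {x y a b : V}
    (ha : T.dist x y = T.dist x a + T.dist a y) (hb : T.dist x y = T.dist x b + T.dist b y)
    (hab : T.dist x a = T.dist x b) : a = b := by
  have h := hT.four_point x y a b
  rw [T.dist_comm (u := y) (v := a), T.dist_comm (u := y) (v := b)] at h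
  rw [← hT.connected.dist_eq_zero_iff]
  omega

/-! ### Lines and projections to them -/

/-- An isometric embedding of `ℤ` into the vertices of the graph. -/
def IsLine (T : SimpleGraph V) (ℓ : ℤ → V) : Prop :=
  ∀ i j, T.dist (ℓ i) (ℓ j) = (i - j).natAbs

/-- The point `ℓ i` is the projection of `x` to the line `ℓ`, recorded by its index: every
geodesic from `x` to a point of the line passes through `ℓ i`. -/
def IsProj (T : SimpleGraph V) (ℓ : ℤ → V) (x : V) (i : ℤ) : Prop :=
  ∀ j, T.dist x (ℓ j) = T.dist x (ℓ i) + (i - j).natAbs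

theorem IsProj.unique {ℓ : ℤ → V} {x : V} {i j : ℤ} (hi : T.IsProj ℓ x i) (hj : T.IsProj ℓ x j) :
    i = j := by
  have h1 := hi j
  have h2 := hj i
  omega

theorem IsLine.isProj_self {ℓ : ℤ → V} (hℓ : T.IsLine ℓ) (i : ℤ) : T.IsProj ℓ (ℓ i) i := by
  intro j
  rw [hℓ, hℓ]
  omega

theorem IsLine.adj {ℓ : ℤ → V} (hℓ : T.IsLine ℓ) (i : ℤ) : T.Adj (ℓ i) (ℓ (i + 1)) := by
  rw [← dist_eq_one_iff_adj, hℓ]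
  omega

theorem IsTree.exists_isProj (hT : T.IsTree) {ℓ : ℤ → V} (hℓ : T.IsLine ℓ) (x : V) :
    ∃ i, T.IsProj ℓ x i := by
  obtain ⟨i, hi⟩ : ∃ i, ∀ j, T.dist x (ℓ i) ≤ T.dist x (ℓ j) :=
    ⟨Function.argmin (fun j => T.dist x (ℓ j)), fun j =>
      Function.argmin_le (fun j => T.dist x (ℓ j)) j⟩
  refine ⟨i, fun j => ?_⟩
  rcases eq_or_ne i j with rfl | hij
  · simp
  have h1 := hT.dist_eq_dist_add_one_of_adj x (hℓ.adj i)
  have h2 := hT.dist_eq_dist_add_one_of_adj x (hℓ.adj (i - 1))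
  rw [sub_add_cancel] at h2
  have h3 := hi (i + 1)
  have h4 := hi (i - 1)
  have f1 := hT.four_point x (ℓ (i + 1)) (ℓ i) (ℓ j)
  have f2 := hT.four_point x (ℓ (i - 1)) (ℓ i) (ℓ j)
  have f3 := hT.connected.dist_triangle (u := x) (v := ℓ i) (w := ℓ j)
  simp only [hℓ _ _] at f1 f2 f3
  omega

/-- If two points have distinct projections to a line, the geodesic between them runs along the
line from one projection to the other. -/
theorem IsTree.dist_eq_of_isProj_ne (hT : T.IsTree) {ℓ : ℤ → V} (hℓ : T.IsLine ℓ) {x y : V}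
    {i j : ℤ} (hx : T.IsProj ℓ x i) (hy : T.IsProj ℓ y j) (hij : i ≠ j) :
    T.dist x y = T.dist x (ℓ i) + (i - j).natAbs + T.dist y (ℓ j) := by
  have f := hT.four_point x (ℓ j) y (ℓ i)
  have f1 := hT.connected.dist_triangle (u := x) (v := ℓ i) (w := y)
  have f2 := hT.connected.dist_triangle (u := ℓ i) (v := ℓ j) (w := y)
  have h1 := hx j
  have h2 := hy i
  rw [hℓ] at f f2
  simp only [T.dist_comm (u := ℓ i) (v := y), T.dist_comm (u := ℓ j) (v := y)] at *
  omega

/-- A point on a geodesic from `x` to its projection has the same projection. -/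
theorem IsProj.of_between (hT : T.IsTree) {ℓ : ℤ → V} (hℓ : T.IsLine ℓ) {x y : V} {i : ℤ}
    (hx : T.IsProj ℓ x i) (hy : T.dist x (ℓ i) = T.dist x y + T.dist y (ℓ i)) :
    T.IsProj ℓ y i := by
  intro j
  have h1 := hx j
  have h2 := hT.connected.dist_triangle (u := x) (v := y) (w := ℓ j)
  have h3 := hT.connected.dist_triangle (u := y) (v := ℓ i) (w := ℓ j)
  rw [hℓ] at h3
  omega

/-- A sequence without backtracking is a geodesic line. -/
theorem IsTree.isLine_of_adj (hT : T.IsTree) {ℓ : ℤ → V} (hadj : ∀ i, T.Adj (ℓ i) (ℓ (i + 1)))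
    (hne : ∀ i, ℓ i ≠ ℓ (i + 2)) : T.IsLine ℓ := by
  have key : ∀ (n : ℕ) (i : ℤ), T.dist (ℓ i) (ℓ (i + n)) = n ∧
      T.dist (ℓ i) (ℓ (i + (n + 1))) = n + 1 := by
    intro n
    induction n with
    | zero =>
      intro i
      simpa using hadj i
    | succ n ih =>
      intro i
      obtain ⟨h1, h2⟩ := ih i
      push_cast
      refine ⟨h2, ?_⟩
      have hA := hadj (i + (n + 1))
      have hB := hadj (i + n)
      rw [add_assoc] at hA hB
      rcases hT.dist_eq_dist_add_one_of_adj (ℓ i) hA with h | h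
      · exfalso
        apply hne (i + n)
        rw [show i + (n : ℤ) + 2 = i + (n + 1 + 1) by ring]
        apply hT.eq_of_adj_of_dist hB.symm hA (y := ℓ i)
        · rw [T.dist_comm, h2, T.dist_comm, h1]
        · rw [T.dist_comm, h, T.dist_comm]
      · rw [h, h2]
  intro i j
  rcases le_total i j with h | h
  · obtain ⟨n, rfl⟩ := Int.le.dest h
    rw [(key n i).1]
    omega
  · obtain ⟨n, rfl⟩ := Int.le.dest h
    rw [T.dist_comm, (key n j).1]
    omega

/-- If two points of a line `ℓ'` project to `ℓ a` and `ℓ b` with `a < b`, then `ℓ'` contains the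
segment of `ℓ` between them. -/
theorem IsTree.exists_overlap (hT : T.IsTree) {ℓ ℓ' : ℤ → V} (hℓ : T.IsLine ℓ)
    (hℓ' : T.IsLine ℓ') {i j a b : ℤ} (hi : T.IsProj ℓ (ℓ' i) a) (hj : T.IsProj ℓ (ℓ' j) b)
    (hab : a < b) :
    ∃ (c ε : ℤ), (ε = 1 ∨ ε = -1) ∧ ∀ t : ℤ, 0 ≤ t → t ≤ b - a → ℓ (a + t) = ℓ' (c + ε * t) := by
  have hd := hT.dist_eq_of_isProj_ne hℓ hi hj hab.ne
  have hij : i ≠ j := by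
    rintro rfl
    exact hab.ne (hi.unique hj)
  rw [hℓ'] at hd
  obtain ⟨ε, hε, hεij⟩ : ∃ ε : ℤ, (ε = 1 ∨ ε = -1) ∧ ((i - j).natAbs : ℤ) = ε * (j - i) := by
    rcases lt_or_gt_of_ne hij with h | h
    · exact ⟨1, Or.inl rfl, by omega⟩
    · exact ⟨-1, Or.inr rfl, by omega⟩
  refine ⟨i + ε * T.dist (ℓ' i) (ℓ a), ε, hε, fun t ht0 ht1 => ?_⟩
  have h1 := hi (a + t)
  have h2 := hj (a + t)
  have hfin : ∀ D : ℕ, (D : ℤ) + t ≤ (i - j).natAbs →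
      (i - (i + ε * D + ε * t)).natAbs = (D + t).natAbs ∧
      (i + ε * D + ε * t - j).natAbs = ((i - j).natAbs - (D + t)).natAbs := by
    intro D hD
    rcases hε with rfl | rfl <;> omega
  obtain ⟨h3, h4⟩ := hfin (T.dist (ℓ' i) (ℓ a)) (by omega)
  apply hT.eq_of_dist_eq_add (x := ℓ' i) (y := ℓ' j)
  · rw [T.dist_comm (u := ℓ (a + t)), hℓ']
    omega
  · rw [hℓ', hℓ', hℓ', h3, h4]
    omega
  · rw [hℓ', h3]
    omega

end SimpleGraph

open SimpleGraph

/-! ### Group actions on trees -/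

section Action

variable {G : Type*} [Group G] {V : Type*} [MulAction G V] {T : SimpleGraph V}

theorem ActsByGraphAutomorphisms.dist_smul (hG : ActsByGraphAutomorphisms G T) (g : G) (x y : V) :
    T.dist (g • x) (g • y) = T.dist x y := by
  let e : T ≃g T := ⟨MulAction.toPerm g, fun {a b} => hG g a b⟩
  by_cases h : T.Reachable x y
  · apply le_antisymm
    · obtain ⟨p, hp⟩ := h.exists_walk_length_eq_dist
      rw [← hp, ← p.length_map e.toHom]
      exact dist_le _
    · obtain ⟨p, hp⟩ := (h.map e.toHom).exists_walk_length_eq_dist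
      have h1 := dist_le (p.map e.symm.toHom)
      rw [Walk.length_map, hp] at h1
      rwa [show e.symm.toHom (e.toHom x) = x from e.symm_apply_apply x,
        show e.symm.toHom (e.toHom y) = y from e.symm_apply_apply y] at h1
  · rw [dist_eq_zero_of_not_reachable h, dist_eq_zero_of_not_reachable]
    exact fun h' => h (e.reachable_iff.1 h')

/-- The element `f` translates the line `ℓ` by `s`. -/
def TranslatesBy (f : G) (ℓ : ℤ → V) (s : ℤ) : Prop :=
  ∀ i, f • ℓ i = ℓ (i + s)

theorem TranslatesBy.inv {f : G} {ℓ : ℤ → V} {s : ℤ} (h : TranslatesBy f ℓ s) :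
    TranslatesBy f⁻¹ ℓ (-s) := by
  intro i
  rw [inv_smul_eq_iff, h]
  simp

theorem TranslatesBy.mul {f f' : G} {ℓ : ℤ → V} {s s' : ℤ} (h : TranslatesBy f ℓ s)
    (h' : TranslatesBy f' ℓ s') : TranslatesBy (f * f') ℓ (s + s') := by
  intro i
  rw [mul_smul, h', h, add_assoc, add_comm s']

theorem TranslatesBy.pow {f : G} {ℓ : ℤ → V} {s : ℤ} (h : TranslatesBy f ℓ s) (n : ℕ) :
    TranslatesBy (f ^ n) ℓ (n * s) := by
  induction n with
  | zero => intro i; simp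
  | succ n ih =>
    rw [pow_succ]
    convert ih.mul h using 1
    push_cast
    ring

theorem TranslatesBy.zpow {f : G} {ℓ : ℤ → V} {s : ℤ} (h : TranslatesBy f ℓ s) (k : ℤ) :
    TranslatesBy (f ^ k) ℓ (k * s) := by
  obtain ⟨n, rfl | rfl⟩ := k.eq_nat_or_neg
  · rw [zpow_natCast]
    exact h.pow n
  · rw [zpow_neg, zpow_natCast, neg_mul]
    exact (h.pow n).inv

theorem TranslatesBy.of_commute {f v : G} {ℓ : ℤ → V} {s : ℤ} (h : TranslatesBy v ℓ s)
    (hfv : Commute f v) : TranslatesBy v (fun i => f • ℓ i) s := by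
  intro i
  change v • f • ℓ i = f • ℓ (i + s)
  rw [← h i, smul_smul, smul_smul, hfv.eq]

theorem SimpleGraph.IsLine.smul (hG : ActsByGraphAutomorphisms G T) {ℓ : ℤ → V}
    (hℓ : T.IsLine ℓ) (f : G) : T.IsLine (fun i => f • ℓ i) := by
  intro i j
  rw [hG.dist_smul, hℓ]

theorem SimpleGraph.IsProj.smul (hG : ActsByGraphAutomorphisms G T) {ℓ : ℤ → V} {x : V} {i : ℤ}
    (hx : T.IsProj ℓ x i) (f : G) : T.IsProj (fun i => f • ℓ i) (f • x) i := by
  intro j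
  rw [hG.dist_smul, hG.dist_smul, hx]

theorem SimpleGraph.IsProj.translate (hG : ActsByGraphAutomorphisms G T) {ℓ : ℤ → V} {x : V}
    {i s : ℤ} {f : G} (hf : TranslatesBy f ℓ s) (hx : T.IsProj ℓ x i) :
    T.IsProj ℓ (f • x) (i + s) := by
  intro j
  have h1 : ℓ j = f • ℓ (j - s) := by rw [hf, sub_add_cancel]
  rw [h1, ← hf, hG.dist_smul, hG.dist_smul, hx]
  omega

/-- An element with no fixed vertex translates a line; closure under roots excludes inversions of
edges. The line is the union of the translates of a geodesic from `p` to
`g • p`, where `p` is a vertex moved as little as possible. -/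
theorem exists_axis (hT : T.IsTree) (hG : ActsByGraphAutomorphisms G T)
    (hroots : ∀ v : V, IsClosedUnderRoots (MulAction.stabilizer G v)) {g : G}
    (hg : ∀ v : V, g • v ≠ v) :
    ∃ (ℓ : ℤ → V) (τ : ℤ), 1 ≤ τ ∧ T.IsLine ℓ ∧ TranslatesBy g ℓ τ := by
  have : Nonempty V := hT.connected.nonempty
  obtain ⟨p, hp⟩ : ∃ p, ∀ q, T.dist p (g • p) ≤ T.dist q (g • q) :=
    ⟨Function.argmin (fun q : V => T.dist q (g • q)),
      fun q => Function.argmin_le (fun q : V => T.dist q (g • q)) q⟩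
  obtain ⟨w, hw, hwl⟩ := hT.connected.exists_path_of_dist p (g • p)
  have hpos : 0 < w.length := by
    rw [hwl]
    exact hT.connected.pos_dist_of_ne (hg p).symm
  obtain ⟨γ, hγ⟩ : ∃ γ : ℤ → V, ∀ n : ℕ, γ n = w.getVert n :=
    ⟨fun i => w.getVert i.toNat, fun n => by simp⟩
  obtain ⟨τ, hτ⟩ : ∃ τ : ℤ, τ = w.length := ⟨_, rfl⟩
  have hτ1 : 1 ≤ τ := by omega
  have hadj : ∀ r : ℤ, 0 ≤ r → r < τ → T.Adj (γ r) (γ (r + 1)) := by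
    intro r h0 h1
    lift r to ℕ using h0
    have := w.adj_getVert_succ (i := r) (by omega)
    rw [← hγ, ← hγ] at this
    exact_mod_cast this
  have hinj : ∀ r : ℤ, 0 ≤ r → r + 2 ≤ τ → γ r ≠ γ (r + 2) := by
    intro r h0 h1 h2
    lift r to ℕ using h0
    have h3 : ((r + 2 : ℕ) : ℤ) = (r : ℤ) + 2 := by push_cast; rfl
    rw [← h3, hγ, hγ] at h2
    have := hw.getVert_injOn (by simp; omega) (by simp; omega) h2
    omega
  have h0 : γ 0 = p := by
    have := hγ 0
    simpa using this
  have hend : γ τ = g • p := by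
    rw [hτ, hγ, Walk.getVert_length]
  let ℓ : ℤ → V := fun i => g ^ (i / τ) • γ (i % τ)
  have hℓ : ∀ q r : ℤ, 0 ≤ r → r ≤ τ → ℓ (τ * q + r) = g ^ q • γ r := by
    intro q r hr0 hr1
    change g ^ ((τ * q + r) / τ) • γ ((τ * q + r) % τ) = _
    rw [Int.mul_add_ediv_left _ _ (by omega), Int.mul_add_emod_self_left]
    rcases hr1.lt_or_eq with h | h
    · rw [Int.ediv_eq_zero_of_lt hr0 h, Int.emod_eq_of_lt hr0 h, add_zero]
    · rw [h, Int.ediv_self (by omega), Int.emod_self, h0, hend, zpow_add_one, mul_smul]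
  have hdecomp : ∀ i : ℤ, ∃ q r : ℤ, 0 ≤ r ∧ r < τ ∧ i = τ * q + r := fun i =>
    ⟨i / τ, i % τ, Int.emod_nonneg _ (by omega), Int.emod_lt_of_pos _ (by omega),
      (Int.mul_ediv_add_emod i τ).symm⟩
  refine ⟨ℓ, τ, hτ1, hT.isLine_of_adj ?_ ?_, ?_⟩
  · intro i
    obtain ⟨q, r, hr0, hr1, rfl⟩ := hdecomp i
    rw [hℓ q r hr0 hr1.le, add_assoc, hℓ q (r + 1) (by omega) (by omega)]
    exact (hG _ _ _).2 (hadj r hr0 hr1)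
  · intro i
    obtain ⟨q, r, hr0, hr1, rfl⟩ := hdecomp i
    rw [hℓ q r hr0 hr1.le]
    rcases le_or_gt (r + 2) τ with h | h
    · rw [add_assoc, hℓ q (r + 2) (by omega) h]
      exact fun h' => hinj r hr0 h (smul_left_cancel _ h')
    -- The remaining possibility is backtracking at a translate of `p`.
    · have hr : r = τ - 1 := by omega
      subst hr
      rw [show τ * q + (τ - 1) + 2 = τ * (q + 1) + 1 by ring, hℓ (q + 1) 1 (by omega) hτ1,
        zpow_add_one, mul_smul]
      intro h'
      have h' := smul_left_cancel _ h'
      rcases hτ1.lt_or_eq with h2 | h2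
      · -- Backtracking would allow `p` to be replaced by the next vertex of the geodesic.
        have hle : ∀ n : ℕ, (1 : ℤ) + n ≤ τ → T.dist (γ 1) (γ (1 + n)) ≤ n := by
          intro n
          induction n with
          | zero => simp
          | succ n ih =>
            intro hn
            push_cast at hn ⊢
            have h3 := ih (by omega)
            have h4 := dist_eq_one_iff_adj.2 (hadj (1 + n) (by omega) (by omega))
            have h5 := hT.connected.dist_triangle (u := γ 1) (v := γ (1 + n)) (w := γ (1 + n + 1))
            rw [← add_assoc]
            omega
        have h3 := hle (τ - 2).toNat (by omega)
        rw [show (1 : ℤ) + ((τ - 2).toNat : ℤ) = τ - 1 by omega, h'] at h3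
        have h4 := hp (γ 1)
        omega
      · -- Backtracking over a single edge means that `g` inverts this edge.
        rw [← h2, sub_self, h0] at h'
        have h3 : γ 1 = g • p := by
          rw [← hend, ← h2]
        rw [h3, smul_smul] at h'
        apply hg p
        refine hroots p g 2 (by norm_num) ?_
        rw [MulAction.mem_stabilizer_iff, zpow_two]
        exact h'.symm
  · intro i
    obtain ⟨q, r, hr0, hr1, rfl⟩ := hdecomp i
    rw [show τ * q + r + τ = τ * (q + 1) + r by ring, hℓ q r hr0 hr1.le, hℓ (q + 1) r hr0 hr1.le,
      smul_smul, ← zpow_one_add, add_comm]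

/-- The axis of a translation is unique up to reparametrisation. -/
theorem SimpleGraph.IsTree.exists_eq_shift (hT : T.IsTree) (hG : ActsByGraphAutomorphisms G T)
    {ℓ ℓ' : ℤ → V} (hℓ : T.IsLine ℓ) (hℓ' : T.IsLine ℓ') {v : G} {s : ℤ} (hs : s ≠ 0)
    (hv : TranslatesBy v ℓ s) (hv' : TranslatesBy v ℓ' s) : ∃ c, ∀ i, ℓ' i = ℓ (i + c) := by
  choose π hπ using fun i => hT.exists_isProj hℓ (ℓ' i)
  have hshift : ∀ i, π (i + s) = π i + s := fun i =>
    (hπ (i + s)).unique (by rw [← hv' i]; exact (hπ i).translate hG hv)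
  have hmem : ∀ i, ℓ' i = ℓ (π i) := by
    intro i
    have h1 := hT.dist_eq_of_isProj_ne hℓ (hπ i) (hπ (i + s)) (by rw [hshift]; omega)
    rw [hshift, hℓ'] at h1
    rw [← hT.connected.dist_eq_zero_iff]
    omega
  have hiso : ∀ i j, (π i - π j).natAbs = (i - j).natAbs := by
    intro i j
    rw [← hℓ, ← hℓ', hmem, hmem]
  refine ⟨π 0, fun i => ?_⟩
  rw [hmem]
  congr 1
  have h1 := hiso i 0
  have h2 := hiso i (0 + s)
  rw [hshift] at h2
  omega

theorem TranslatesBy.exists_of_commute (hT : T.IsTree) (hG : ActsByGraphAutomorphisms G T)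
    {ℓ : ℤ → V} (hℓ : T.IsLine ℓ) {f v : G} {s : ℤ} (hs : s ≠ 0) (hv : TranslatesBy v ℓ s)
    (hfv : Commute f v) : ∃ c, TranslatesBy f ℓ c :=
  hT.exists_eq_shift hG hℓ (hℓ.smul hG f) hs hv (hv.of_commute hfv)

/-- If some nontrivial power of `f` translates a line, possibly by zero, then so does `f`. -/
theorem TranslatesBy.exists_of_zpow (hT : T.IsTree) (hG : ActsByGraphAutomorphisms G T)
    (hroots : ∀ v : V, IsClosedUnderRoots (MulAction.stabilizer G v)) {ℓ : ℤ → V}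
    (hℓ : T.IsLine ℓ) {f : G} {k s : ℤ} (hk : k ≠ 0) (hf : TranslatesBy (f ^ k) ℓ s) :
    ∃ c, TranslatesBy f ℓ c := by
  by_cases hs : s = 0
  · refine ⟨0, fun i => ?_⟩
    rw [add_zero]
    refine hroots (ℓ i) f k hk ?_
    rw [MulAction.mem_stabilizer_iff, hf, hs, add_zero]
  · exact TranslatesBy.exists_of_commute hT hG hℓ hs hf (Commute.refl f |>.zpow_right k)

/-! ### Two elliptic elements -/

/-- If `p` is a fixed vertex of `f` nearest to `q`, then the geodesic from `p` to `q` and its image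
under `f` meet only in `p`. -/
theorem dist_smul_eq_of_fixed (hT : T.IsTree) (hG : ActsByGraphAutomorphisms G T) {f : G}
    {p q : V} (hp : f • p = p) (hpq : p ≠ q)
    (hmin : ∀ x, f • x = x → T.dist p q ≤ T.dist x q) :
    T.dist q (f • q) = T.dist p q + T.dist p q := by
  obtain ⟨p₁, hadj, hd⟩ := hT.connected.exists_adj_dist_succ hpq
  have hadj' : T.Adj p (f • p₁) := by
    have := (hG f p p₁).2 hadj
    rwa [hp] at this
  have hd' : T.dist p (f • q) = T.dist p q := by
    conv_lhs => rw [← hp]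
    rw [hG.dist_smul]
  have hd1' : T.dist (f • p₁) (f • q) = T.dist p₁ q := hG.dist_smul _ _ _
  have htri := hT.connected.dist_triangle (u := q) (v := p) (w := f • q)
  rw [T.dist_comm (u := q) (v := p)] at htri
  -- Otherwise the neighbour `p₁` of `p` towards `q` is fixed by `f` as well.
  by_contra hne
  have h4 := hT.four_point p₁ (f • q) p q
  have hone := dist_eq_one_iff_adj.2 hadj
  have heq : T.dist p (f • q) = T.dist p₁ (f • q) + 1 := by
    rcases hT.dist_eq_dist_add_one_of_adj (f • q) hadj with h | h
    · rwa [T.dist_comm, T.dist_comm (v := p₁)] at h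
    · rw [T.dist_comm, T.dist_comm (v := p)] at h
      rw [T.dist_comm (u := p₁) (v := p), T.dist_comm (u := f • q) (v := q),
        T.dist_comm (u := f • q) (v := p)] at h4
      omega
  have hfix : f • p₁ = p₁ :=
    (hT.eq_of_adj_of_dist hadj hadj' heq (by omega)).symm
  have := hmin p₁ hfix
  omega

/-- Two elliptic elements without a common fixed vertex generate their free product: powers of
each map the far side of the bridge between the fixed subtrees into its own side. -/
theorem generatesFreeGroupOfRankTwo_of_elliptic (hT : T.IsTree)
    (hG : ActsByGraphAutomorphisms G T)
    (hroots : ∀ v : V, IsClosedUnderRoots (MulAction.stabilizer G v)) {g h : G} {x y : V}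
    (hx : g • x = x) (hy : h • y = y) (hgh : ∀ v : V, ¬(g • v = v ∧ h • v = v)) :
    GeneratesFreeGroupOfRankTwo g h := by
  have hfix : ∀ (f : G) (k : ℤ), k ≠ 0 → ∀ v : V, f ^ k • v = v ↔ f • v = v := fun f k hk v =>
    ⟨fun hv => hroots v f k hk hv,
      fun hv => (MulAction.stabilizer G v).zpow_mem (x := f) hv k⟩
  obtain ⟨⟨⟨p, hp⟩, ⟨q, hq⟩⟩, hmin⟩ :
      ∃ z : {v : V // g • v = v} × {v : V // h • v = v}, ∀ z' : {v : V // g • v = v} ×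
        {v : V // h • v = v}, T.dist (z.1 : V) z.2 ≤ T.dist (z'.1 : V) z'.2 := by
    have : Nonempty ({v : V // g • v = v} × {v : V // h • v = v}) := ⟨⟨x, hx⟩, ⟨y, hy⟩⟩
    let φ : {v : V // g • v = v} × {v : V // h • v = v} → ℕ := fun z => T.dist (z.1 : V) z.2
    exact ⟨Function.argmin φ, fun z' => Function.argmin_le φ z'⟩
  have hpq : p ≠ q := by
    rintro rfl
    exact hgh p ⟨hp, hq⟩
  have hD := hT.connected.pos_dist_of_ne hpq
  refine generatesFreeGroupOfRankTwo_of_ping_pong g h {z | T.dist z p < T.dist z q}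
    {z | T.dist z q ≤ T.dist z p} ⟨p, by simpa using hD⟩ ⟨q, by simp⟩ ?_ ?_ ?_
  · rw [Set.disjoint_left]
    intro z h1 h2
    change T.dist z p < T.dist z q at h1
    change T.dist z q ≤ T.dist z p at h2
    omega
  · intro k hk z hz
    have h2 := dist_smul_eq_of_fixed hT hG (f := (g ^ k)⁻¹) (p := p) (q := q)
      (by rw [inv_smul_eq_iff, eq_comm, hfix g k hk]; exact hp) hpq
      (fun v hv => hmin ⟨⟨v, by rwa [inv_smul_eq_iff, eq_comm, hfix g k hk] at hv⟩, ⟨q, hq⟩⟩)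
    have hgp : g ^ k • p = p := (hfix g k hk p).2 hp
    have h3 : T.dist (g ^ k • z) p = T.dist z p := by
      conv_lhs => rw [← hgp]
      rw [hG.dist_smul]
    have h4 : T.dist (g ^ k • z) q = T.dist z ((g ^ k)⁻¹ • q) := by
      rw [← hG.dist_smul (g ^ k) z, smul_inv_smul]
    have h5 : T.dist p ((g ^ k)⁻¹ • q) = T.dist p q := by
      rw [← hG.dist_smul (g ^ k), smul_inv_smul, hgp]
    change T.dist (g ^ k • z) p < T.dist (g ^ k • z) q
    change T.dist z q ≤ T.dist z p at hz
    have f1 := hT.four_point z p q ((g ^ k)⁻¹ • q)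
    omega
  · intro k hk z hz
    have hqp : T.dist q p = T.dist p q := T.dist_comm
    have h2 := dist_smul_eq_of_fixed hT hG (f := (h ^ k)⁻¹) (p := q) (q := p)
      (by rw [inv_smul_eq_iff, eq_comm, hfix h k hk]; exact hq) hpq.symm
      (fun v hv => by
        rw [hqp, T.dist_comm (u := v)]
        exact hmin ⟨⟨p, hp⟩, ⟨v, by rwa [inv_smul_eq_iff, eq_comm, hfix h k hk] at hv⟩⟩)
    have hhq : h ^ k • q = q := (hfix h k hk q).2 hq
    have h3 : T.dist (h ^ k • z) q = T.dist z q := by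
      conv_lhs => rw [← hhq]
      rw [hG.dist_smul]
    have h4 : T.dist (h ^ k • z) p = T.dist z ((h ^ k)⁻¹ • p) := by
      rw [← hG.dist_smul (h ^ k) z, smul_inv_smul]
    have h5 : T.dist q ((h ^ k)⁻¹ • p) = T.dist q p := by
      rw [← hG.dist_smul (h ^ k), smul_inv_smul, hhq]
    change T.dist (h ^ k • z) q ≤ T.dist (h ^ k • z) p
    change T.dist z p < T.dist z q at hz
    have f1 := hT.four_point z q p ((h ^ k)⁻¹ • p)
    omega

end Action

/-! ### Consequences of acylindricity -/

/-- Acylindricity at displacement zero: at most `N` elements fix two given vertices at distance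
more than `R`. -/
def HasBoundedPairStabilizers (G : Type*) [Group G] {V : Type*} [MulAction G V]
    (T : SimpleGraph V) (R N : ℕ) : Prop :=
  ∀ x y : V, R < T.dist x y → {g : G | g • x = x ∧ g • y = y}.encard ≤ (N : ℕ∞)

theorem IsAcylindricalAction.exists_hasBoundedPairStabilizers {G : Type*} [Group G] {V : Type*}
    [MulAction G V] {T : SimpleGraph V} (h : IsAcylindricalAction G T) :
    ∃ R N : ℕ, HasBoundedPairStabilizers G T R N := by
  obtain ⟨R, N, hRN⟩ := h 0 le_rfl
  refine ⟨⌈R⌉₊, N, fun x y hxy => (Set.encard_le_encard ?_).trans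
    (hRN x y ((Nat.le_ceil R).trans_lt (by exact_mod_cast hxy)))⟩
  rintro g ⟨hx, hy⟩
  simp [hx, hy]

section Acylindrical

variable {G : Type*} [Group G] {V : Type*} [MulAction G V] {T : SimpleGraph V} {R N : ℕ}

theorem HasBoundedPairStabilizers.exists_eq (hac : HasBoundedPairStabilizers G T R N) {x y : V}
    (hxy : R < T.dist x y) (z : ℕ → G) (hz : ∀ j ≤ N, z j • x = x ∧ z j • y = y) :
    ∃ i j : ℕ, i < j ∧ j ≤ N ∧ z i = z j := by
  have hle := hac x y hxy
  by_contra! hne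
  have hinj : Set.InjOn z (Set.Iic N) := by
    intro i hi j hj hij
    rcases lt_trichotomy i j with h | h | h
    · exact absurd hij (hne i j h hj)
    · exact h
    · exact absurd hij.symm (hne j i h hi)
  have h1 := hinj.encard_image
  have h2 : (z '' Set.Iic N).encard ≤ N := by
    refine (Set.encard_le_encard ?_).trans hle
    rintro _ ⟨j, hj, rfl⟩
    exact hz j hj
  rw [h1, ← Finset.coe_Iic, Set.encard_coe_eq_coe_finsetCard, Nat.card_Iic, Nat.cast_le] at h2
  omega

/-- Elements of finite order act trivially on the tree when vertex stabilisers are closed under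
roots, so acylindricity bounds their order. -/
theorem HasBoundedPairStabilizers.hasBoundedTorsion (hac : HasBoundedPairStabilizers G T R N)
    (hroots : ∀ v : V, IsClosedUnderRoots (MulAction.stabilizer G v))
    (hinf : HasInfiniteDiameter T) : HasBoundedTorsion G := by
  obtain ⟨x, y, hxy⟩ := hinf R
  refine ⟨N, fun g hg => ?_⟩
  have hfix : ∀ v : V, g ∈ MulAction.stabilizer G v := by
    intro v
    refine hroots v g (orderOf g) ?_ ?_
    · exact_mod_cast (orderOf_pos_iff.2 hg).ne'
    · rw [zpow_natCast, pow_orderOf_eq_one]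
      exact one_mem _
  by_contra! hlt
  obtain ⟨i, j, hij, hj, h⟩ := hac.exists_eq hxy (fun j => g ^ j) fun j _ =>
    ⟨(MulAction.stabilizer G x).pow_mem (hfix x) j, (MulAction.stabilizer G y).pow_mem (hfix y) j⟩
  have := pow_injOn_Iio_orderOf (x := g) (show i < orderOf g by omega)
    (show j < orderOf g by omega) h
  omega

/-- A coincidence `[g, h ^ i] = [g, h ^ j]` makes `g` commute with `h ^ (j - i)`. -/
theorem commute_pow_of_commutator_eq {g h : G} {i j : ℕ} (hij : i < j)
    (heq : g * h ^ i * g⁻¹ * (h ^ i)⁻¹ = g * h ^ j * g⁻¹ * (h ^ j)⁻¹) :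
    Commute g (h ^ (j - i)) := by
  obtain ⟨m, rfl⟩ := Nat.exists_eq_add_of_lt hij
  have h1 : h ^ (i + m + 1) = h ^ i * h ^ (m + 1) := by rw [← pow_add, add_assoc]
  have h2 : h ^ (i + m + 1) = h ^ (m + 1) * h ^ i := by rw [← pow_add]; congr 1; omega
  have h3 : i + m + 1 - i = m + 1 := by omega
  rw [h3]
  have h4 : g⁻¹ = h ^ (m + 1) * g⁻¹ * (h ^ (m + 1))⁻¹ := by
    have h5 := heq
    nth_rewrite 1 [h1] at h5
    rw [h2, mul_inv_rev] at h5
    have h6 : g * h ^ i * (g⁻¹ * (h ^ i)⁻¹) =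
        g * h ^ i * (h ^ (m + 1) * g⁻¹ * (h ^ i)⁻¹ * (h ^ (m + 1))⁻¹) := by
      simpa only [mul_assoc] using h5
    have h7 := mul_left_cancel h6
    have h8 : (h ^ i)⁻¹ * (h ^ (m + 1))⁻¹ = (h ^ (m + 1))⁻¹ * (h ^ i)⁻¹ := by
      rw [← mul_inv_rev, ← mul_inv_rev, ← pow_add, ← pow_add, add_comm]
    rw [mul_assoc _ (h ^ i)⁻¹, h8, ← mul_assoc _ (h ^ (m + 1))⁻¹] at h7
    exact mul_right_cancel h7
  have h5 : Commute g⁻¹ (h ^ (m + 1)) := by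
    rw [eq_mul_inv_iff_mul_eq] at h4
    exact h4
  simpa using h5.inv_left

/-- If `g` and `h` translate a common line, their commutators fix it pointwise, so there are only
boundedly many of the form `[g, h ^ j]`. -/
theorem exists_commute_of_translatesBy (hac : HasBoundedPairStabilizers G T R N) {ℓ : ℤ → V}
    (hℓ : T.IsLine ℓ) {g h : G} {s s' : ℤ} (hg : TranslatesBy g ℓ s) (hh : TranslatesBy h ℓ s') :
    ∃ m, 1 ≤ m ∧ m ≤ N ∧ Commute g (h ^ m) := by
  have hfix : ∀ (j : ℕ) (i : ℤ), (g * h ^ j * g⁻¹ * (h ^ j)⁻¹) • ℓ i = ℓ i := by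
    intro j i
    rw [((hg.mul (hh.pow j)).mul hg.inv).mul (hh.pow j).inv]
    congr 1
    ring
  obtain ⟨i, j, hij, hj, h⟩ := hac.exists_eq (x := ℓ 0) (y := ℓ (R + 1)) (by rw [hℓ]; omega)
    (fun j => g * h ^ j * g⁻¹ * (h ^ j)⁻¹) fun j _ => ⟨hfix j _, hfix j _⟩
  exact ⟨j - i, by omega, by omega, commute_pow_of_commutator_eq hij h⟩

/-- If the axis of `g` has a long overlap with its image under `f`, then `f` conjugates some power
of `g` to itself or to its inverse, so `f ^ 2` commutes with it: the elements
`g⁻ʲ (f g f⁻¹)^{±j}` fix a long segment of the overlap. -/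
theorem exists_commute_sq_of_long_proj (hT : T.IsTree) (hG : ActsByGraphAutomorphisms G T)
    (hac : HasBoundedPairStabilizers G T R N) {ℓ : ℤ → V} (hℓ : T.IsLine ℓ) {g f : G} {τ : ℤ}
    (hτ : 1 ≤ τ) (hg : TranslatesBy g ℓ τ) {i j a b : ℤ} (hi : T.IsProj ℓ (f • ℓ i) a)
    (hj : T.IsProj ℓ (f • ℓ j) b) (hab : (N + R + 1) * τ ≤ b - a) :
    ∃ m, 1 ≤ m ∧ Commute (f ^ 2) (g ^ m) := by
  have hpos : 0 < (N + R + 1 : ℤ) * τ := by positivity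
  obtain ⟨c, ε, hε, hov⟩ := hT.exists_overlap hℓ (hℓ.smul hG f) hi hj (by omega)
  have hεε : ε * ε = 1 := by rcases hε with rfl | rfl <;> norm_num
  have hconj : TranslatesBy (f * g * f⁻¹) (fun i => f • ℓ i) τ := by
    intro i
    change (f * g * f⁻¹) • f • ℓ i = f • ℓ (i + τ)
    rw [← hg i, smul_smul, smul_smul]
    congr 1
    group
  have hfix : ∀ n : ℕ, n ≤ N → ∀ t : ℤ, 0 ≤ t → t ≤ R + 1 →
      ((g ^ n)⁻¹ * (f * g * f⁻¹) ^ (ε * n)) • ℓ (a + t) = ℓ (a + t) := by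
    intro n hn t ht0 ht1
    have hnτ : 0 ≤ (n : ℤ) * τ := by positivity
    have hbound : (n : ℤ) * τ + (R + 1) ≤ (N + R + 1) * τ := by
      have h1 : (n : ℤ) * τ ≤ N * τ := by gcongr
      have h2 : (R + 1 : ℤ) ≤ (R + 1) * τ := le_mul_of_one_le_right (by positivity) hτ
      linarith
    rw [mul_smul, hov t ht0 (by omega), hconj.zpow]
    have h1 : c + ε * t + ε * n * τ = c + ε * (t + n * τ) := by ring
    rw [h1, ← hov t ht0 (by omega)]
    change (g ^ n)⁻¹ • f • ℓ (c + ε * (t + n * τ)) = _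
    rw [← hov _ (by omega) (by omega), (hg.pow n).inv]
    congr 1
    ring
  obtain ⟨n, k, hnk, -, h⟩ := hac.exists_eq (x := ℓ (a + 0)) (y := ℓ (a + (R + 1)))
    (by rw [hℓ]; omega) (fun n => (g ^ n)⁻¹ * (f * g * f⁻¹) ^ (ε * n)) fun n hn =>
      ⟨hfix n hn 0 le_rfl (by omega), hfix n hn (R + 1) (by omega) le_rfl⟩
  refine ⟨k - n, by omega, ?_⟩
  -- The coincidence says that conjugation by `f` takes `g ^ (ε * (k - n))` to `g ^ (k - n)`.
  have hswap : f * g ^ (ε * (k - n : ℤ)) * f⁻¹ = g ^ (k - n : ℤ) := by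
    rw [← conj_zpow, mul_sub, zpow_sub, zpow_sub, zpow_natCast, zpow_natCast]
    have h1 : (f * g * f⁻¹) ^ (ε * k) = g ^ k * ((g ^ n)⁻¹ * (f * g * f⁻¹) ^ (ε * n)) := by
      rw [h, mul_inv_cancel_left]
    rw [h1]
    group
  have hswap' : f * g ^ (k - n : ℤ) * f⁻¹ = g ^ (ε * (k - n : ℤ)) := by
    have h1 : f * g ^ (k - n : ℤ) * f⁻¹ = (f * g ^ (ε * (k - n : ℤ)) * f⁻¹) ^ ε := by
      rw [conj_zpow, ← zpow_mul, mul_right_comm, hεε, one_mul]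
    rw [h1, hswap, ← zpow_mul, mul_comm]
  have hcast : g ^ (k - n) = g ^ (k - n : ℤ) := by
    rw [← Nat.cast_sub hnk.le, zpow_natCast]
  rw [hcast]
  change f ^ 2 * _ = _ * f ^ 2
  rw [mul_inv_eq_iff_eq_mul] at hswap hswap'
  rw [pow_two, mul_assoc, hswap', ← mul_assoc, hswap, mul_assoc]

/-- If the axes of `g` and `h` have a long overlap, then `g` commutes with a bounded power of
`h`, since the commutators `[g, h ^ {±j}]` fix a long segment of the overlap. -/
theorem exists_commute_of_long_overlap (hT : T.IsTree)
    (hac : HasBoundedPairStabilizers G T R N) {ℓ ℓ' : ℤ → V} (hℓ : T.IsLine ℓ)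
    (hℓ' : T.IsLine ℓ') {g h : G} {τ τ' : ℤ} (hτ' : 1 ≤ τ') (hle : τ' ≤ τ)
    (hg : TranslatesBy g ℓ τ) (hh : TranslatesBy h ℓ' τ') {i j a b : ℤ}
    (hi : T.IsProj ℓ (ℓ' i) a) (hj : T.IsProj ℓ (ℓ' j) b) (hab : (N + R + 2) * τ ≤ b - a) :
    ∃ m, 1 ≤ m ∧ m ≤ N ∧ Commute g (h ^ m) := by
  have hτ : 1 ≤ τ := hτ'.trans hle
  have hpos : 0 < (N + R + 2 : ℤ) * τ := by positivity
  obtain ⟨c, ε, hε, hov⟩ := hT.exists_overlap hℓ hℓ' hi hj (by omega)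
  have hbound : (N + 1 : ℤ) * τ + (R + 1) ≤ (N + R + 2) * τ := by
    have h2 : (R + 1 : ℤ) ≤ (R + 1) * τ := le_mul_of_one_le_right (by positivity) hτ
    linarith
  have hstep : ∀ (k t : ℤ), 0 ≤ t → t ≤ b - a → 0 ≤ t + k * τ' → t + k * τ' ≤ b - a →
      (h ^ ε) ^ k • ℓ (a + t) = ℓ (a + (t + k * τ')) := by
    intro k t ht0 ht1 hk0 hk1
    rw [hov t ht0 ht1, (hh.zpow ε).zpow, hov _ hk0 hk1]
    congr 1
    ring
  have hfix : ∀ n : ℕ, n ≤ N → ∀ t : ℤ, (N + 1) * τ ≤ t → t ≤ (N + 1) * τ + (R + 1) →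
      (g * (h ^ ε) ^ n * g⁻¹ * ((h ^ ε) ^ n)⁻¹) • ℓ (a + t) = ℓ (a + t) := by
    intro n hn t ht0 ht1
    have hnτ : 0 ≤ (n : ℤ) * τ' := by positivity
    have h1 : (n : ℤ) * τ' ≤ N * τ := by gcongr
    have h2 : (N + 1 : ℤ) * τ = N * τ + τ := by ring
    rw [mul_smul, mul_smul, mul_smul, ← zpow_natCast, ← zpow_neg,
      hstep _ _ (by omega) (by omega) (by rw [neg_mul]; omega) (by rw [neg_mul]; omega), hg.inv,
      add_assoc, hstep _ _ (by rw [neg_mul]; omega) (by rw [neg_mul]; omega)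
        (by rw [neg_mul]; omega) (by rw [neg_mul]; omega), hg]
    congr 1
    ring
  obtain ⟨n, k, hnk, hk, h⟩ := hac.exists_eq (x := ℓ (a + (N + 1) * τ))
    (y := ℓ (a + ((N + 1) * τ + (R + 1)))) (by rw [hℓ]; omega)
    (fun n => g * (h ^ ε) ^ n * g⁻¹ * ((h ^ ε) ^ n)⁻¹) fun n hn =>
      ⟨hfix n hn _ le_rfl (by omega), hfix n hn _ (by omega) le_rfl⟩
  refine ⟨k - n, by omega, by omega, ?_⟩
  have hc := commute_pow_of_commutator_eq hnk h
  rcases hε with rfl | rfl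
  · simpa using hc
  · simpa using hc

end Acylindrical

/-! ### A hyperbolic element and an arbitrary element -/

section Hyperbolic

variable {G : Type*} [Group G] {V : Type*} [MulAction G V] {T : SimpleGraph V} {R N : ℕ}

/-- Ping-pong for a translation `u` of a line `ℓ` and an element `w`, all of whose nontrivial powers
send `ℓ` to lines with projection to `ℓ` in a ball that is short compared with the translation
length: the sets are the vertices projecting into the ball and outside it. The inclusion for
powers of `w` is an instance of Behrstock's inequality. -/
theorem generatesFreeGroupOfRankTwo_of_proj (hT : T.IsTree) (hG : ActsByGraphAutomorphisms G T)
    {ℓ : ℤ → V} (hℓ : T.IsLine ℓ) {u w : G} {σ p c : ℤ} (hu : TranslatesBy u ℓ σ)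
    (hw : ∀ k : ℤ, k ≠ 0 → ∀ i r : ℤ, T.IsProj ℓ (w ^ k • ℓ i) r → |r - p| ≤ c)
    (hc0 : 0 ≤ c) (hc : 2 * c < σ) : GeneratesFreeGroupOfRankTwo u w := by
  have hex := hT.exists_isProj hℓ
  refine generatesFreeGroupOfRankTwo_of_ping_pong u w
    {x | ∃ i, T.IsProj ℓ x i ∧ c < |i - p|} {x | ∃ i, T.IsProj ℓ x i ∧ |i - p| ≤ c}
    ⟨ℓ (p + (c + 1)), _, hℓ.isProj_self _, ?_⟩ ⟨ℓ p, _, hℓ.isProj_self _, by simpa using hc0⟩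
    ?_ ?_ ?_
  · rw [add_sub_cancel_left]
    exact (lt_add_one c).trans_le (le_abs_self _)
  · rw [Set.disjoint_left]
    rintro x ⟨i, hi, h1⟩ ⟨j, hj, h2⟩
    rw [hi.unique hj] at h1
    omega
  · rintro k hk x ⟨i, hi, h1⟩
    refine ⟨i + k * σ, hi.translate hG (hu.zpow k), ?_⟩
    have hkσ : σ ≤ |k * σ| := by
      rw [abs_mul, abs_of_pos (show 0 < σ by omega)]
      exact le_mul_of_one_le_left (by omega) (Int.one_le_abs hk)
    have h2 : |k * σ| ≤ |i + k * σ - p| + |i - p| := by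
      have := abs_sub (i + k * σ - p) (i - p)
      rwa [show i + k * σ - p - (i - p) = k * σ by ring] at this
    omega
  · rintro k hk x ⟨i, hi, h1⟩
    obtain ⟨r, hr⟩ := hex (w ^ k • x)
    refine ⟨r, hr, ?_⟩
    by_contra! hrc
    have hi' := hi.smul hG (w ^ k)
    have hℓ' := hℓ.smul hG (w ^ k)
    -- `w ^ k • ℓ m` is the projection of `ℓ r` to the translated line.
    obtain ⟨m, hm⟩ := hT.exists_isProj hℓ' (ℓ r)
    have hmp : |m - p| ≤ c := by
      refine hw (-k) (by omega) r m ?_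
      have := hm.smul hG (w ^ (-k))
      convert this using 2 with j
      rw [smul_smul, zpow_neg, inv_mul_cancel, one_smul]
    obtain ⟨d, hd⟩ := hex (w ^ k • ℓ m)
    have hdp := hw k hk m d hd
    have him : i ≠ m := by
      rintro rfl
      omega
    have hdr : d ≠ r := by
      rintro rfl
      omega
    have e1 := hT.dist_eq_of_isProj_ne hℓ' hi' hm him
    have e2 := hi' m
    have e3 := hr d
    have e4 := hd r
    have e5 := hT.connected.dist_triangle (u := w ^ k • x) (v := w ^ k • ℓ m) (w := ℓ d)
    simp only [T.dist_comm (u := ℓ r) (v := w ^ k • ℓ m)] at *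
    omega

/-- A fixed vertex `v` of `f` forces the projection of `f • ℓ` to `ℓ` to contain the projection of
`v`. -/
theorem isProj_smul_of_fixed (hT : T.IsTree) (hG : ActsByGraphAutomorphisms G T) {ℓ : ℤ → V}
    (hℓ : T.IsLine ℓ) {f : G} {v : V} (hv : f • v = v) {p : ℤ} (hp : T.IsProj ℓ v p) :
    T.IsProj ℓ (f • ℓ p) p := by
  obtain ⟨r, hr⟩ := hT.exists_isProj hℓ (f • ℓ p)
  by_cases h : p = r
  · rwa [← h] at hr
  · exfalso
    have e1 := hT.dist_eq_of_isProj_ne hℓ hp hr h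
    have e2 := hG.dist_smul f v (ℓ p)
    rw [hv] at e2
    omega

/-- If `ℓ p` and `ℓ' q` are projections of each other and `f` translates `ℓ'` nontrivially, then
`f • ℓ p` and `f • ℓ' q` have the same projection to `ℓ`. -/
theorem isProj_smul_of_translatesBy (hT : T.IsTree) (hG : ActsByGraphAutomorphisms G T)
    {ℓ ℓ' : ℤ → V} (hℓ : T.IsLine ℓ) (hℓ' : T.IsLine ℓ') {p q : ℤ}
    (hp : T.IsProj ℓ (ℓ' q) p) (hq : T.IsProj ℓ' (ℓ p) q) {f : G} {s : ℤ} (hs : s ≠ 0)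
    (hf : TranslatesBy f ℓ' s) {p' : ℤ} (hp' : T.IsProj ℓ (ℓ' (q + s)) p') :
    T.IsProj ℓ (f • ℓ p) p' := by
  obtain ⟨r, hr⟩ := hT.exists_isProj hℓ (f • ℓ p)
  by_cases h : r = p'
  · rwa [h] at hr
  exfalso
  have hy : T.IsProj ℓ' (f • ℓ p) (q + s) := hq.translate hG hf
  have e1 := hT.dist_eq_of_isProj_ne hℓ hr hp' h
  have e2 := hp' r
  have hrq : T.IsProj ℓ' (ℓ r) (q + s) := by
    refine hy.of_between hT hℓ' ?_
    rw [T.dist_comm (u := ℓ r)]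
    omega
  have e3 := hT.dist_eq_of_isProj_ne hℓ' hq hrq (by omega)
  rw [hℓ, T.dist_comm (u := ℓ r), T.dist_comm (u := ℓ p)] at e3
  have e4 : T.dist (f • ℓ p) (ℓ' (q + s)) = T.dist (ℓ' q) (ℓ p) := by
    rw [← hf, hG.dist_smul, T.dist_comm]
  by_cases hpp : p = p'
  · subst hpp
    omega
  have e5 := hT.dist_eq_of_isProj_ne hℓ hp hp' hpp
  rw [hℓ'] at e5
  omega

/-- Two lines have a pair of points that are projections of each other. -/
theorem exists_mutual_proj (hT : T.IsTree) {ℓ ℓ' : ℤ → V} (hℓ : T.IsLine ℓ)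
    (hℓ' : T.IsLine ℓ') : ∃ p q, T.IsProj ℓ (ℓ' q) p ∧ T.IsProj ℓ' (ℓ p) q := by
  obtain ⟨q, hq⟩ := hT.exists_isProj hℓ' (ℓ 0)
  obtain ⟨p, hp⟩ := hT.exists_isProj hℓ (ℓ' q)
  refine ⟨p, q, hp, hq.of_between hT hℓ' ?_⟩
  have h := hp 0
  rw [T.dist_comm (u := ℓ 0), h, hℓ, T.dist_comm (u := ℓ p)]
  omega

/-- The power alternative for a hyperbolic element `g` and an element `h` that is elliptic or
hyperbolic of no larger translation length. If `g` commutes with no power `h ^ m`, `1 ≤ m ≤ N`,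
then the projections of the lines `h ^ k • ℓ`, `k ≠ 0`, to the axis `ℓ` of `g` have diameter less
than `(N + R + 1) * τ`, and each meets the ball of radius `(N + R + 2) * τ` about one point of `ℓ`;
a power of `g` moves the resulting ball of radius `(2 * N + 2 * R + 3) * τ` off itself. -/
theorem exists_commute_or_generatesFreeGroupOfRankTwo (hT : T.IsTree)
    (hG : ActsByGraphAutomorphisms G T)
    (hroots : ∀ v : V, IsClosedUnderRoots (MulAction.stabilizer G v))
    (hac : HasBoundedPairStabilizers G T R N) {ℓ : ℤ → V} (hℓ : T.IsLine ℓ) {g h : G} {τ : ℤ}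
    (hτ : 1 ≤ τ) (hg : TranslatesBy g ℓ τ)
    (hh : (∃ v : V, h • v = v) ∨ ∃ (ℓ' : ℤ → V) (τ' : ℤ), T.IsLine ℓ' ∧ 1 ≤ τ' ∧ τ' ≤ τ ∧
      TranslatesBy h ℓ' τ') {n : ℕ} (hn : 2 * (2 * N + 2 * R + 3) < n) :
    (∃ m, 1 ≤ m ∧ m ≤ N ∧ Commute g (h ^ m)) ∨ GeneratesFreeGroupOfRankTwo (g ^ n) (h ^ n) := by
  by_cases hcomm : ∃ m, 1 ≤ m ∧ m ≤ N ∧ Commute g (h ^ m)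
  · exact Or.inl hcomm
  right
  have hpos1 : 0 ≤ (N + R + 1 : ℤ) * τ := by positivity
  have hpos2 : 0 ≤ (N + R + 2 : ℤ) * τ := by positivity
  have hsum : (2 * N + 2 * R + 3 : ℤ) * τ = (N + R + 1) * τ + (N + R + 2) * τ := by ring
  have hdiam : ∀ k : ℤ, k ≠ 0 → ∀ i j a b : ℤ, T.IsProj ℓ (h ^ k • ℓ i) a →
      T.IsProj ℓ (h ^ k • ℓ j) b → b - a < (N + R + 1) * τ := by
    intro k hk i j a b ha hb
    by_contra! hlt
    obtain ⟨m, hm, hc⟩ := exists_commute_sq_of_long_proj hT hG hac hℓ hτ hg ha hb hlt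
    obtain ⟨s, hs⟩ := TranslatesBy.exists_of_commute hT hG hℓ
      (mul_ne_zero (by omega) (by omega)) (hg.pow m) hc
    rw [← zpow_natCast, ← zpow_mul] at hs
    obtain ⟨s', hs'⟩ := hs.exists_of_zpow hT hG hroots hℓ (mul_ne_zero hk (by norm_num))
    exact hcomm (exists_commute_of_translatesBy hac hℓ hg hs')
  have hcentre : ∃ p, ∀ k : ℤ, k ≠ 0 → ∃ i r, T.IsProj ℓ (h ^ k • ℓ i) r ∧
      |r - p| ≤ (N + R + 2) * τ := by
    rcases hh with ⟨v, hv⟩ | ⟨ℓ', τ', hℓ', hτ', hle, hh⟩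
    · obtain ⟨p, hp⟩ := hT.exists_isProj hℓ v
      refine ⟨p, fun k _ => ⟨p, p, isProj_smul_of_fixed hT hG hℓ ?_ hp, by simpa using hpos2⟩⟩
      exact (MulAction.stabilizer G v).zpow_mem (x := h) hv k
    · obtain ⟨p, q, hp, hq⟩ := exists_mutual_proj hT hℓ hℓ'
      refine ⟨p, fun k hk => ?_⟩
      have hs : k * τ' ≠ 0 := mul_ne_zero hk (by omega)
      obtain ⟨p', hp'⟩ := hT.exists_isProj hℓ (ℓ' (q + k * τ'))
      refine ⟨p, p', isProj_smul_of_translatesBy hT hG hℓ hℓ' hp hq hs (hh.zpow k) hp', ?_⟩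
      by_contra! hlt
      apply hcomm
      rcases lt_abs.1 hlt with h1 | h1
      · exact exists_commute_of_long_overlap hT hac hℓ hℓ' hτ' hle hg hh hp hp' h1.le
      · exact exists_commute_of_long_overlap hT hac hℓ hℓ' hτ' hle hg hh hp' hp (by omega)
  obtain ⟨p, hp⟩ := hcentre
  refine generatesFreeGroupOfRankTwo_of_proj hT hG hℓ (p := p) (c := (2 * N + 2 * R + 3) * τ)
    (hg.pow n) ?_ (by omega) ?_
  · intro k hk i r hr
    have hnk : (n : ℤ) * k ≠ 0 := mul_ne_zero (by omega) hk
    rw [← zpow_natCast, ← zpow_mul] at hr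
    obtain ⟨i₀, r₀, hr₀, hle⟩ := hp _ hnk
    have h1 := hdiam _ hnk _ _ _ _ hr hr₀
    have h2 := hdiam _ hnk _ _ _ _ hr₀ hr
    rw [abs_le] at hle ⊢
    omega
  · rw [← mul_assoc]
    exact mul_lt_mul_of_pos_right (by exact_mod_cast hn) (by omega)

end Hyperbolic

/-! ### The uniform power alternative -/

/-- By cocompactness only finitely many conjugacy classes of vertex stabilisers matter, so one
exponent serves all pairs with a common fixed vertex. -/
theorem exists_uniform_exponent_of_common_fixed {G : Type*} [Group G] {V : Type*} [MulAction G V]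
    {T : SimpleGraph V} (hcocpt : IsCocompactAction G T)
    (hPA : ∀ v : V, powerAlternativeConstant (MulAction.stabilizer G v) < ⊤) :
    ∃ n : ℕ, 1 ≤ n ∧ ∀ (g h : G) (v : V), g • v = v → h • v = v → PowerAlternativeAt n g h := by
  obtain ⟨K, hK, hcov, -⟩ := hcocpt
  choose B hB using fun v => exists_powerAlternativeAt_of_constant_lt_top (hPA v)
  obtain ⟨M, hM⟩ := (hK.image B).bddAbove
  refine ⟨M.factorial, M.factorial_pos, fun g h v hg hh => ?_⟩
  obtain ⟨f, hf⟩ := hcov v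
  -- Conjugation by `f` carries the stabiliser of `v` to that of a vertex of the finite subgraph.
  have hmem : ∀ x : G, x • v = v → f * x * f⁻¹ ∈ MulAction.stabilizer G (f • v) := by
    intro x hx
    rw [MulAction.mem_stabilizer_iff, mul_smul, inv_smul_smul, mul_smul, hx]
  obtain ⟨k, hk1, hkB, hk⟩ := hB (f • v) ⟨_, hmem g hg⟩ ⟨_, hmem h hh⟩
  have hkM : k ≤ M := hkB.trans (hM ⟨_, hf, rfl⟩)
  have h1 := (powerAlternativeAt_map_iff _ (Subgroup.subtype_injective _) _ _ _).2 hk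
  have h2 : PowerAlternativeAt k g h :=
    (powerAlternativeAt_map_iff (MulAut.conj f).toMonoidHom (MulAut.conj f).injective _ _ _).1 h1
  exact h2.of_dvd (Nat.dvd_factorial hk1 hkM)

theorem mainTheorem9 {G : Type*} [Group G] {V : Type*} [MulAction G V]
    (T : SimpleGraph V) (hT : T.IsTree)
    (hG : ActsByGraphAutomorphisms G T)
    (hacyl : IsAcylindricalAction G T)
    (hcocpt : IsCocompactAction G T)
    (hPA : ∀ v : V, powerAlternativeConstant (MulAction.stabilizer G v) < ⊤)
    (hroots : ∀ v : V, IsClosedUnderRoots (MulAction.stabilizer G v)) :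
    powerAlternativeConstant G < ⊤ ∧ UniformPowerAlternative G ∧
      (HasInfiniteDiameter T → HasBoundedTorsion G) := by

  obtain ⟨R, N, hac⟩ := hacyl.exists_hasBoundedPairStabilizers
  obtain ⟨n₀, hn₀, hell⟩ := exists_uniform_exponent_of_common_fixed hcocpt hPA
  let c := 2 * (2 * N + 2 * R + 3) + 1
  let n := n₀ * N.factorial * c
  have hNf := N.factorial_pos
  have hn : 2 * (2 * N + 2 * R + 3) < n := by
    have : 1 * c ≤ n := Nat.mul_le_mul_right c (Nat.mul_pos hn₀ hNf)
    omega
  have hhyp : ∀ g h : G, ∀ (ℓ : ℤ → V) (τ : ℤ), T.IsLine ℓ → 1 ≤ τ → TranslatesBy g ℓ τ →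
      ((∃ v : V, h • v = v) ∨ ∃ (ℓ' : ℤ → V) (τ' : ℤ), T.IsLine ℓ' ∧ 1 ≤ τ' ∧ τ' ≤ τ ∧
        TranslatesBy h ℓ' τ') → PowerAlternativeAt n g h := by
    intro g h ℓ τ hℓ hτ hg hh
    rcases exists_commute_or_generatesFreeGroupOfRankTwo hT hG hroots hac hℓ hτ hg hh hn with
      ⟨m, hm1, hmN, hc⟩ | hF
    · obtain ⟨d, hd⟩ : m ∣ n :=
        ((Nat.dvd_factorial hm1 hmN).mul_left n₀).mul_right c
      have hhn : h ^ n = (h ^ m) ^ d := by rw [hd, pow_mul]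
      left
      rw [hhn]
      exact hc.pow_pow n d
    · exact Or.inr hF
  have hunif : UniformPowerAlternative G := by
    refine ⟨n, by omega, fun g h => ?_⟩
    by_cases hg : ∃ x : V, g • x = x <;> by_cases hh : ∃ y : V, h • y = y
    · by_cases hgh : ∃ v : V, g • v = v ∧ h • v = v
      · obtain ⟨v, hgv, hhv⟩ := hgh
        exact (hell g h v hgv hhv).of_dvd ((dvd_mul_right _ _).mul_right c)
      · obtain ⟨x, hx⟩ := hg
        obtain ⟨y, hy⟩ := hh
        have hF : PowerAlternativeAt 1 g h := by
          right
          rw [pow_one, pow_one]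
          exact generatesFreeGroupOfRankTwo_of_elliptic hT hG hroots hx hy
            fun v hv => hgh ⟨v, hv⟩
        exact hF.of_dvd (one_dvd n)
    · push Not at hh
      obtain ⟨ℓ, τ, hτ, hℓ, hhℓ⟩ := exists_axis hT hG hroots hh
      exact (hhyp h g ℓ τ hℓ hτ hhℓ (Or.inl hg)).symm
    · push Not at hg
      obtain ⟨ℓ, τ, hτ, hℓ, hgℓ⟩ := exists_axis hT hG hroots hg
      exact hhyp g h ℓ τ hℓ hτ hgℓ (Or.inl hh)
    · push Not at hg hh
      obtain ⟨ℓ, τ, hτ, hℓ, hgℓ⟩ := exists_axis hT hG hroots hg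
      obtain ⟨ℓ', τ', hτ', hℓ', hhℓ'⟩ := exists_axis hT hG hroots hh
      rcases le_total τ' τ with hle | hle
      · exact hhyp g h ℓ τ hℓ hτ hgℓ (Or.inr ⟨ℓ', τ', hℓ', hτ', hle, hhℓ'⟩)
      · exact (hhyp h g ℓ' τ' hℓ' hτ' hhℓ' (Or.inr ⟨ℓ, τ, hℓ, hτ, hle, hgℓ⟩)).symm
  exact ⟨hunif.powerAlternativeConstant_lt_top, hunif, hac.hasBoundedTorsion hroots⟩
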